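/- Let $\mathbb T=\{\zeta\in\mathbb C:|\zeta|=1\}$. For $0<\alpha<1$ let $\Lambda_\alpha(\mathbb T)$ be the class of functions $f:\mathbb T\to\mathbb C$ with $$\|f\|_{\Lambda_\alpha}:=\sup_{\zeta\ne\tau}\frac{|f(\zeta)-f(\tau)|}{|\zeta-\tau|^{\alpha}}<\infty .$$ For a unitary operator $U$ on a complex Hilbert space, $f(U)$ denotes the operator given by the functional calculus of $U$. **Theorem.** There is an absolute constant $c>0$ such that for every $\alpha\in(0,1)$, every $f\in\Lambda_\alpha(\mathbb T)$, every complex Hilbert space $H$ and all unitary operators $U$ and $V$ on $H$, $$\|f(U)-f(V)\|\le\frac{8c}{1-2^{\alpha-1}}\,\|f\|_{\Lambda_\alpha}\,\|U-V\|^{\alpha}.$$ -/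

import Mathlib

open scoped NNReal

/-- The operator `f(U)` for a continuous function `f` on the unit circle and a unitary operator `U`
on a complex Hilbert space: the continuous functional calculus of the normal operator `U`. As the
spectrum of `U` lies on the unit circle, the values of the extension of `f` outside the circle are
irrelevant. -/
noncomputable def circleFun {H : Type*} [NormedAddCommGroup H] [InnerProductSpace ℂ H]
    [CompleteSpace H] (f : Circle → ℂ) (U : unitary (H →L[ℂ] H)) : H →L[ℂ] H :=
  cfc (Function.extend (fun z : Circle => (z : ℂ)) f 0) (U : H →L[ℂ] H)

open MeasureTheory

noncomputable section

namespace CirclePoisson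

/-- The Borel σ-algebra on the circle. -/
local instance : MeasurableSpace Circle := borel Circle

local instance : BorelSpace Circle := ⟨rfl⟩

/-- The normalized Haar measure on the circle. -/
def haar : Measure Circle := Measure.haarMeasure ⊤

instance : IsProbabilityMeasure haar :=
  ⟨by simpa [haar] using!
      Measure.haarMeasure_self (K₀ := (⊤ : TopologicalSpace.PositiveCompacts Circle))⟩

instance : haar.IsMulLeftInvariant := by unfold haar; infer_instance

lemma integrable_of_continuous {E : Type*} [NormedAddCommGroup E] {f : Circle → E}
    (hf : Continuous f) : Integrable f haar :=
  hf.integrable_of_hasCompactSupport (HasCompactSupport.of_compactSpace f)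

/-- Integration against Haar measure, as a continuous linear functional. -/
def mean : C(Circle, ℂ) →L[ℂ] ℂ :=
  LinearMap.mkContinuous
    { toFun := fun f => ∫ ζ, f ζ ∂haar
      map_add' := fun f g =>
        integral_add (integrable_of_continuous f.continuous) (integrable_of_continuous g.continuous)
      map_smul' := fun c f => integral_smul c f } 1 fun f => by
    simpa using norm_integral_le_of_norm_le_const (μ := haar) (.of_forall f.norm_coe_le_norm)

lemma mean_apply (f : C(Circle, ℂ)) : mean f = ∫ ζ, f ζ ∂haar := rfl

/-- The inclusion of the circle in the complex plane. -/
def coord : C(Circle, ℂ) := ⟨fun w => (w : ℂ), by fun_prop⟩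

@[simp] lemma coord_apply (w : Circle) : coord w = w := rfl

lemma star_coord_mul_coord : star coord * coord = 1 := by
  ext w
  simp [← Circle.coe_inv_eq_conj]

lemma mean_star (f : C(Circle, ℂ)) : mean (star f) = star (mean f) := by
  simp only [mean_apply, ContinuousMap.star_apply]
  exact integral_conj

lemma mean_one : mean 1 = 1 := by simp [mean_apply]

lemma mean_coord_pow {n : ℕ} (hn : n ≠ 0) : mean (coord ^ n) = 0 := by
  set a : Circle := Circle.exp (Real.pi / n)
  have ha : (a : ℂ) ^ n = -1 := by
    rw [← Circle.coe_pow, ← Circle.exp_nsmul, nsmul_eq_mul, mul_div_cancel₀ _ (by exact_mod_cast hn)]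
    simp
  have h := integral_mul_left_eq_self (μ := haar) (fun ζ : Circle => (ζ : ℂ) ^ n) a
  simp only [Circle.coe_mul, mul_pow, ha] at h
  rw [integral_const_mul] at h
  have : mean (coord ^ n) = ∫ ζ : Circle, (ζ : ℂ) ^ n ∂haar := by simp [mean_apply]
  rw [this]
  linear_combination (-1 / 2) * h

variable {r : ℝ}

lemma norm_mul_circle (hr : r ∈ Set.Ico (0 : ℝ) 1) (ζ w : Circle) :
    ‖(r : ℂ) * ((ζ⁻¹ : Circle) : ℂ) * w‖ = r := by
  rw [norm_mul, norm_mul, Circle.norm_coe, Circle.norm_coe, Complex.norm_real,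
    Real.norm_of_nonneg hr.1, mul_one, mul_one]

lemma one_sub_ne_zero (hr : r ∈ Set.Ico (0 : ℝ) 1) (ζ w : Circle) :
    1 - (r : ℂ) * ((ζ⁻¹ : Circle) : ℂ) * w ≠ 0 := by
  intro h
  have := norm_mul_circle hr ζ w
  rw [← sub_eq_zero.1 h, norm_one] at this
  exact hr.2.ne this.symm

/-- The family of functions `w ↦ (1 - r ζ⁻¹ w)⁻¹` on the circle. -/
def szego (hr : r ∈ Set.Ico (0 : ℝ) 1) : C(Circle, C(Circle, ℂ)) :=
  ContinuousMap.curry ⟨fun p => (1 - (r : ℂ) * ((p.1⁻¹ : Circle) : ℂ) * p.2)⁻¹,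
    Continuous.inv₀ (by fun_prop) fun p => one_sub_ne_zero hr p.1 p.2⟩

lemma szego_apply (hr : r ∈ Set.Ico (0 : ℝ) 1) (ζ w : Circle) :
    szego hr ζ w = (1 - (r : ℂ) * ((ζ⁻¹ : Circle) : ℂ) * w)⁻¹ := rfl

lemma szego_mul (hr : r ∈ Set.Ico (0 : ℝ) 1) (ζ : Circle) :
    szego hr ζ * (1 - ((r : ℂ) * ((ζ⁻¹ : Circle) : ℂ)) • coord) = 1 := by
  ext w
  simpa [szego_apply] using inv_mul_cancel₀ (one_sub_ne_zero hr ζ w)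

lemma star_szego_apply (hr : r ∈ Set.Ico (0 : ℝ) 1) (ζ w : Circle) :
    star (szego hr ζ w) = szego hr w ζ := by
  simp [szego_apply, ← Circle.coe_inv_eq_conj, mul_right_comm]

lemma hasSum_szego (hr : r ∈ Set.Ico (0 : ℝ) 1) (ζ : Circle) :
    HasSum (fun n : ℕ => ((r : ℂ) * ((ζ⁻¹ : Circle) : ℂ)) ^ n • coord ^ n) (szego hr ζ) := by
  set x : C(Circle, ℂ) := ((r : ℂ) * ((ζ⁻¹ : Circle) : ℂ)) • coord
  have hx : ‖x‖ < 1 := by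
    refine lt_of_le_of_lt ((ContinuousMap.norm_le _ hr.1).2 fun w => ?_) hr.2
    simpa [x] using (norm_mul_circle hr ζ w).le
  have h := (summable_geometric_of_norm_lt_one hx).hasSum
  have e : szego hr ζ = ∑' n, x ^ n := by
    calc szego hr ζ = szego hr ζ * ((1 - x) * ∑' n, x ^ n) := by
          rw [mul_neg_geom_series x hx, mul_one]
      _ = _ := by rw [← mul_assoc, szego_mul, one_mul]
  rw [e]
  simpa only [x, smul_pow] using h

/-- The Poisson kernel `∑ r ^ |n| ζ ^ (-n) w ^ n`. -/
def kernel (hr : r ∈ Set.Ico (0 : ℝ) 1) : C(Circle, C(Circle, ℂ)) :=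
  szego hr + star (szego hr) - 1

lemma kernel_apply (hr : r ∈ Set.Ico (0 : ℝ) 1) (ζ : Circle) :
    kernel hr ζ = szego hr ζ + star (szego hr ζ) - 1 := rfl

lemma kernel_symm (hr : r ∈ Set.Ico (0 : ℝ) 1) (ζ w : Circle) :
    kernel hr ζ w = kernel hr w ζ := by
  simp only [kernel_apply, ContinuousMap.sub_apply, ContinuousMap.add_apply,
    ContinuousMap.star_apply, star_szego_apply, ContinuousMap.one_apply]
  ring

lemma kernel_eq (hr : r ∈ Set.Ico (0 : ℝ) 1) (ζ : Circle) :
    kernel hr ζ = ((1 - r ^ 2 : ℝ) : ℂ) • (star (szego hr ζ) * szego hr ζ) := by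
  ext w
  simp only [kernel_apply, ContinuousMap.sub_apply, ContinuousMap.add_apply, smul_eq_mul,
    ContinuousMap.smul_apply, ContinuousMap.mul_apply,
    ContinuousMap.star_apply, star_szego_apply, ContinuousMap.one_apply]
  simp only [szego_apply]
  have h1 := one_sub_ne_zero hr ζ w
  have h2 := one_sub_ne_zero hr w ζ
  have h3 : ((ζ⁻¹ : Circle) : ℂ) * ζ = 1 := by simp
  have h4 : ((w⁻¹ : Circle) : ℂ) * w = 1 := by simp
  set a := ((ζ⁻¹ : Circle) : ℂ)
  set b := ((w⁻¹ : Circle) : ℂ)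
  rw [eq_comm]
  field_simp
  push_cast
  linear_combination ((r : ℂ) ^ 2 * b * w) * h3 + (r : ℂ) ^ 2 * h4

/-- The Poisson kernel as a real function. -/
lemma kernel_eq_ofReal (hr : r ∈ Set.Ico (0 : ℝ) 1) (ζ w : Circle) :
    kernel hr ζ w = (((1 - r ^ 2) * ‖szego hr ζ w‖ ^ 2 : ℝ) : ℂ) := by
  rw [kernel_eq]
  simp [← Complex.conj_mul']

lemma kernel_norm (hr : r ∈ Set.Ico (0 : ℝ) 1) (ζ w : Circle) :
    ((‖kernel hr ζ w‖ : ℝ) : ℂ) = kernel hr ζ w := by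
  rw [kernel_eq_ofReal, Complex.norm_real, Real.norm_of_nonneg]
  have := hr.1
  have := hr.2
  have : 0 ≤ 1 - r ^ 2 := by nlinarith
  positivity

/-- Convolution with the Poisson kernel. -/
def poisson (hr : r ∈ Set.Ico (0 : ℝ) 1) : C(Circle, ℂ) →L[ℂ] C(Circle, ℂ) :=
  LinearMap.mkContinuous
    { toFun := fun f => ∫ ζ, f ζ • kernel hr ζ ∂haar
      map_add' := fun f g => by
        simp only [ContinuousMap.add_apply, add_smul]
        exact integral_add (integrable_of_continuous (by fun_prop))
          (integrable_of_continuous (by fun_prop))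
      map_smul' := fun c f => by
        simp only [ContinuousMap.smul_apply, smul_assoc, RingHom.id_apply]
        exact integral_smul c _ } ‖kernel hr‖ fun f => by
    have h : ∀ ζ, ‖f ζ • kernel hr ζ‖ ≤ ‖kernel hr‖ * ‖f‖ := fun ζ => by
      rw [norm_smul, mul_comm]
      gcongr
      · exact (kernel hr).norm_coe_le_norm ζ
      · exact f.norm_coe_le_norm ζ
    simpa using norm_integral_le_of_norm_le_const (μ := haar) (.of_forall h)

lemma poisson_def (hr : r ∈ Set.Ico (0 : ℝ) 1) (f : C(Circle, ℂ)) :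
    poisson hr f = ∫ ζ, f ζ • kernel hr ζ ∂haar := rfl

lemma map_poisson {E : Type*} [NormedAddCommGroup E] [NormedSpace ℂ E] [CompleteSpace E]
    (hr : r ∈ Set.Ico (0 : ℝ) 1) (D : C(Circle, ℂ) →L[ℂ] E) (f : C(Circle, ℂ)) :
    D (poisson hr f) = ∫ ζ, f ζ • D (kernel hr ζ) ∂haar := by
  rw [poisson_def, ← D.integral_comp_comm (integrable_of_continuous (by fun_prop))]
  simp only [map_smul]

lemma poisson_apply (hr : r ∈ Set.Ico (0 : ℝ) 1) (f : C(Circle, ℂ)) (w : Circle) :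
    poisson hr f w = mean (f * kernel hr w) := by
  rw [mean_apply]
  simpa [kernel_symm hr _ w] using! map_poisson hr (ContinuousMap.evalCLM ℂ w) f

lemma poisson_star (hr : r ∈ Set.Ico (0 : ℝ) 1) (f : C(Circle, ℂ)) :
    poisson hr (star f) = star (poisson hr f) := by
  ext w
  rw [ContinuousMap.star_apply, poisson_apply, poisson_apply, ← mean_star]
  congr 1
  ext ζ
  simp [kernel_eq_ofReal]

lemma poisson_coord_pow (hr : r ∈ Set.Ico (0 : ℝ) 1) (n : ℕ) :
    poisson hr (coord ^ n) = ((r : ℂ) ^ n) • coord ^ n := by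
  ext w
  have h1 : mean (coord ^ n * szego hr w) = mean (coord ^ n) := by
    let M : C(Circle, ℂ) →L[ℂ] ℂ := mean.comp (ContinuousLinearMap.mul ℂ _ (coord ^ n))
    have h := (hasSum_szego hr w).mapL M
    have h' := hasSum_single (f := fun k : ℕ => M (((r : ℂ) * ((w⁻¹ : Circle) : ℂ)) ^ k • coord ^ k)) 0
      fun k hk => by
        simp [M, ← pow_add, mean_coord_pow (show n + k ≠ 0 by omega)]
    simpa [M] using h.unique h'
  have h2 : mean (coord ^ n * star (szego hr w)) = (r : ℂ) ^ n * w ^ n := by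
    let M : C(Circle, ℂ) →L[ℂ] ℂ := mean.comp (ContinuousLinearMap.mul ℂ _ (star coord ^ n))
    have h := (hasSum_szego hr w).mapL M
    have h' := hasSum_single (f := fun k : ℕ => M (((r : ℂ) * ((w⁻¹ : Circle) : ℂ)) ^ k • coord ^ k)) n
      fun k hk => by
        suffices mean (star coord ^ n * coord ^ k) = 0 by simp [M, this]
        rcases lt_or_gt_of_ne hk with hk | hk
        · obtain ⟨d, rfl⟩ := Nat.exists_eq_add_of_lt hk
          have : star coord ^ (k + d + 1) * coord ^ k = star (coord ^ (d + 1)) := by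
            rw [add_assoc, add_comm k, pow_add, mul_assoc, ← mul_pow, star_coord_mul_coord,
              one_pow, mul_one, star_pow]
          rw [this, mean_star, mean_coord_pow (by omega), star_zero]
        · obtain ⟨d, rfl⟩ := Nat.exists_eq_add_of_lt hk
          have : star coord ^ n * coord ^ (n + d + 1) = coord ^ (d + 1) := by
            rw [add_assoc, pow_add, ← mul_assoc, ← mul_pow, star_coord_mul_coord,
              one_pow, one_mul]
          rw [this, mean_coord_pow (by omega)]
    have h3 := congrArg star (h.unique h')
    have h4 : star coord ^ n * coord ^ n = 1 := by
      rw [← mul_pow, star_coord_mul_coord, one_pow]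
    simp only [M, ContinuousLinearMap.comp_apply, ContinuousLinearMap.mul_apply', ← mean_star,
      h4, map_smul, mean_one] at h3
    simpa [mul_pow, mul_comm, ← Circle.coe_inv_eq_conj] using h3
  rw [poisson_apply, kernel_apply, mul_sub, mul_add, map_sub, map_add, h1, h2]
  simp

lemma poisson_one (hr : r ∈ Set.Ico (0 : ℝ) 1) : poisson hr 1 = 1 := by
  simpa using poisson_coord_pow hr 0

lemma mean_kernel (hr : r ∈ Set.Ico (0 : ℝ) 1) (w : Circle) : mean (kernel hr w) = 1 := by
  simpa [poisson_one] using (poisson_apply hr 1 w).symm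

lemma norm_poisson_le (hr : r ∈ Set.Ico (0 : ℝ) 1) (f : C(Circle, ℂ)) : ‖poisson hr f‖ ≤ ‖f‖ := by
  refine (ContinuousMap.norm_le _ (norm_nonneg f)).2 fun w => ?_
  rw [poisson_apply, mean_apply]
  have h1 : ∫ ζ, ‖kernel hr w ζ‖ ∂haar = 1 := by
    have h : ((∫ ζ, ‖kernel hr w ζ‖ ∂haar : ℝ) : ℂ) = 1 := by
      rw [← mean_kernel hr w, mean_apply, ← integral_complex_ofReal]
      exact integral_congr_ae (.of_forall (kernel_norm hr w))
    exact_mod_cast h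
  calc ‖∫ ζ, (f * kernel hr w) ζ ∂haar‖ ≤ ∫ ζ, ‖f‖ * ‖kernel hr w ζ‖ ∂haar := by
        refine norm_integral_le_of_norm_le (integrable_of_continuous (by fun_prop))
          (.of_forall fun ζ => ?_)
        simp only [ContinuousMap.mul_apply, norm_mul]
        gcongr
        exact f.norm_coe_le_norm ζ
    _ = ‖f‖ := by rw [integral_const_mul, h1, mul_one]

lemma mul_mem_Ico {s : ℝ} (hr : r ∈ Set.Ico (0 : ℝ) 1) (hs : s ∈ Set.Ico (0 : ℝ) 1) :
    r * s ∈ Set.Ico (0 : ℝ) 1 :=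
  ⟨mul_nonneg hr.1 hs.1, mul_lt_one_of_nonneg_of_lt_one_left hr.1 hr.2 hs.2.le⟩

lemma poisson_poisson {s : ℝ} (hr : r ∈ Set.Ico (0 : ℝ) 1) (hs : s ∈ Set.Ico (0 : ℝ) 1)
    (f : C(Circle, ℂ)) : poisson hr (poisson hs f) = poisson (mul_mem_Ico hr hs) f := by
  rw [map_poisson, poisson_def]
  congr 1
  ext1 ζ
  have h : poisson hr (szego hs ζ) = szego (mul_mem_Ico hr hs) ζ := by
    refine ((hasSum_szego hs ζ).mapL (poisson hr)).unique ?_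
    convert hasSum_szego (mul_mem_Ico hr hs) ζ using 2 with n
    rw [map_smul, poisson_coord_pow, smul_smul]
    push_cast
    ring_nf
  rw [kernel_apply, kernel_apply, map_sub, map_add, poisson_star, h, poisson_one]

variable {H : Type*} [NormedAddCommGroup H] [InnerProductSpace ℂ H] [CompleteSpace H]

/-- A star homomorphism on continuous functions on the circle, as a continuous linear map. -/
def toCLM (Φ : C(Circle, ℂ) →⋆ₐ[ℂ] (H →L[ℂ] H)) : C(Circle, ℂ) →L[ℂ] (H →L[ℂ] H) :=
  LinearMap.mkContinuous (Φ : C(Circle, ℂ) →ₗ[ℂ] (H →L[ℂ] H)) 1 fun f => by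
    simpa using NonUnitalStarAlgHom.norm_apply_le Φ f

@[simp] lemma toCLM_apply (Φ : C(Circle, ℂ) →⋆ₐ[ℂ] (H →L[ℂ] H)) (f : C(Circle, ℂ)) :
    toCLM Φ f = Φ f := rfl

lemma continuous_starAlgHom (Φ : C(Circle, ℂ) →⋆ₐ[ℂ] (H →L[ℂ] H)) : Continuous Φ :=
  (toCLM Φ).continuous

lemma resolvent_identity (Φ Ψ : C(Circle, ℂ) →⋆ₐ[ℂ] (H →L[ℂ] H)) (hr : r ∈ Set.Ico (0 : ℝ) 1)
    (ζ : Circle) :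
    Φ (szego hr ζ) - Ψ (szego hr ζ) =
      ((r : ℂ) * ((ζ⁻¹ : Circle) : ℂ)) •
        (Φ (szego hr ζ) * (Φ coord - Ψ coord) * Ψ (szego hr ζ)) := by
  set a := (r : ℂ) * ((ζ⁻¹ : Circle) : ℂ)
  have h1 : Φ (szego hr ζ) * (1 - a • Φ coord) = 1 := by
    simpa only [map_mul, map_sub, map_one, map_smul] using congrArg Φ (szego_mul hr ζ)
  have h2 : (1 - a • Ψ coord) * Ψ (szego hr ζ) = 1 := by
    simpa only [map_mul, map_sub, map_one, map_smul] using
      congrArg Ψ ((mul_comm _ _).trans (szego_mul hr ζ))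
  calc Φ (szego hr ζ) - Ψ (szego hr ζ)
      = Φ (szego hr ζ) * ((1 - a • Ψ coord) * Ψ (szego hr ζ)) -
        Φ (szego hr ζ) * (1 - a • Φ coord) * Ψ (szego hr ζ) := by rw [h1, h2, mul_one, one_mul]
    _ = Φ (szego hr ζ) * (a • (Φ coord - Ψ coord)) * Ψ (szego hr ζ) := by
        rw [smul_sub]; noncomm_ring
    _ = _ := by rw [mul_smul_comm, smul_mul_assoc]

lemma opNorm_le_of_norm_inner_le {E : Type*} [NormedAddCommGroup E]
    [InnerProductSpace ℂ E] {T : E →L[ℂ] E} {B : ℝ} (hB : 0 ≤ B)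
    (h : ∀ x y : E, ‖x‖ = 1 → ‖y‖ = 1 → ‖inner ℂ y (T x)‖ ≤ B) : ‖T‖ ≤ B := by
  refine ContinuousLinearMap.opNorm_le_of_unit_norm hB fun x hx => ?_
  by_cases h0 : T x = 0
  · simpa [h0] using hB
  have hn : ‖T x‖ ≠ 0 := norm_ne_zero_iff.2 h0
  have := h x (((‖T x‖⁻¹ : ℝ) : ℂ) • T x) hx (by simp [norm_smul, hn])
  rw [inner_smul_left, inner_self_eq_norm_sq_to_K] at this
  simpa [pow_two, hn] using this

lemma norm_sq_apply (T : H →L[ℂ] H) (x : H) :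
    ((‖T x‖ ^ 2 : ℝ) : ℂ) = inner ℂ x ((star T * T) x) := by
  rw [ContinuousLinearMap.star_eq_adjoint, mul_apply_eq_comp,
    ContinuousLinearMap.adjoint_inner_right, inner_self_eq_norm_sq_to_K]
  simp

/-- The square function of the resolvents. -/
lemma integral_norm_sq (Φ : C(Circle, ℂ) →⋆ₐ[ℂ] (H →L[ℂ] H)) (hr : r ∈ Set.Ico (0 : ℝ) 1) (x : H) :
    ∫ ζ, ‖Φ (szego hr ζ) x‖ ^ 2 ∂haar = ‖x‖ ^ 2 / (1 - r ^ 2) := by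
  have h0 : 0 < 1 - r ^ 2 := by have := hr.1; have := hr.2; nlinarith
  let M : C(Circle, ℂ) →L[ℂ] ℂ :=
    (innerSL ℂ x).comp ((ContinuousLinearMap.apply ℂ H x).comp (toCLM Φ))
  have hM : ∀ f, M f = inner ℂ x (Φ f x) := fun f => rfl
  have h := map_poisson hr M 1
  rw [poisson_one, hM, map_one] at h
  have h1 : ∀ ζ, (1 : C(Circle, ℂ)) ζ • M (kernel hr ζ) =
      (((1 - r ^ 2) * ‖Φ (szego hr ζ) x‖ ^ 2 : ℝ) : ℂ) := fun ζ => by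
    rw [kernel_eq, map_smul, hM, map_mul, map_star, Complex.ofReal_mul, norm_sq_apply]
    simp
  simp_rw [h1] at h
  rw [integral_complex_ofReal, integral_const_mul] at h
  have h2 : ‖x‖ ^ 2 = (1 - r ^ 2) * ∫ ζ, ‖Φ (szego hr ζ) x‖ ^ 2 ∂haar := by
    have : inner ℂ x ((1 : H →L[ℂ] H) x) = ((‖x‖ ^ 2 : ℝ) : ℂ) := by
      simp [inner_self_eq_norm_sq_to_K]
    rw [this] at h
    exact_mod_cast h
  rw [h2, mul_div_cancel_left₀ _ h0.ne']

lemma norm_integral_szego_le (Φ Ψ : C(Circle, ℂ) →⋆ₐ[ℂ] (H →L[ℂ] H))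
    (hr : r ∈ Set.Ico (0 : ℝ) 1) (g : C(Circle, ℂ)) :
    ‖∫ ζ, g ζ • (Φ (szego hr ζ) - Ψ (szego hr ζ)) ∂haar‖ ≤
      r / (1 - r ^ 2) * ‖g‖ * ‖Φ coord - Ψ coord‖ := by
  have h0 : 0 < 1 - r ^ 2 := by have := hr.1; have := hr.2; nlinarith
  have hr0 := hr.1
  have hΦ := continuous_starAlgHom Φ
  have hΨ := continuous_starAlgHom Ψ
  set δ := ‖Φ coord - Ψ coord‖
  refine opNorm_le_of_norm_inner_le (by positivity) fun x y hx hy => ?_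
  let M : (H →L[ℂ] H) →L[ℂ] ℂ := (innerSL ℂ y).comp (ContinuousLinearMap.apply ℂ H x)
  have hM : ∀ T, M T = inner ℂ y (T x) := fun T => rfl
  rw [← hM, ← M.integral_comp_comm (integrable_of_continuous (by fun_prop))]
  have hpt : ∀ ζ, ‖M (g ζ • (Φ (szego hr ζ) - Ψ (szego hr ζ)))‖ ≤
      (r * ‖g‖ * δ / 2) *
        (‖Φ (star (szego hr ζ)) y‖ ^ 2 + ‖Ψ (szego hr ζ) x‖ ^ 2) := fun ζ => by
    rw [map_smul, resolvent_identity, map_smul, hM, map_star, norm_smul, norm_smul, norm_mul,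
      Circle.norm_coe, mul_one, Complex.norm_real, Real.norm_of_nonneg hr0,
      mul_apply_eq_comp, mul_apply_eq_comp,
      ← ContinuousLinearMap.adjoint_inner_left, ← ContinuousLinearMap.star_eq_adjoint]
    set u := star (Φ (szego hr ζ)) y
    set v := Ψ (szego hr ζ) x
    have h1 : ‖inner ℂ u ((Φ coord - Ψ coord) v)‖ ≤ ‖u‖ * (δ * ‖v‖) :=
      (norm_inner_le_norm _ _).trans
        (by gcongr; exact ContinuousLinearMap.le_opNorm _ _)
    have h2 : ‖u‖ * (δ * ‖v‖) ≤ δ / 2 * (‖u‖ ^ 2 + ‖v‖ ^ 2) := by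
      have : 0 ≤ δ := norm_nonneg _
      nlinarith [mul_nonneg this (sq_nonneg (‖u‖ - ‖v‖))]
    calc ‖g ζ‖ * (r * ‖inner ℂ u ((Φ coord - Ψ coord) v)‖)
        ≤ ‖g‖ * (r * (δ / 2 * (‖u‖ ^ 2 + ‖v‖ ^ 2))) := by
          gcongr
          · exact g.norm_coe_le_norm ζ
          · exact h1.trans h2
      _ = _ := by ring
  have hs : ∫ ζ, ‖Φ (star (szego hr ζ)) y‖ ^ 2 ∂haar = ‖y‖ ^ 2 / (1 - r ^ 2) := by
    rw [← integral_norm_sq Φ hr y]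
    congr 1
    ext1 ζ
    apply Complex.ofReal_injective
    rw [norm_sq_apply, norm_sq_apply, ← map_star Φ, ← map_star Φ, ← map_mul, ← map_mul, star_star,
      mul_comm]
  refine (norm_integral_le_of_norm_le (integrable_of_continuous (by fun_prop))
    (.of_forall hpt)).trans_eq ?_
  rw [integral_const_mul, integral_add (integrable_of_continuous (by fun_prop))
    (integrable_of_continuous (by fun_prop)), hs, integral_norm_sq, hx, hy]
  ring

/-- The operator Bernstein inequality for Poisson means. -/
theorem norm_sub_poisson_le (Φ Ψ : C(Circle, ℂ) →⋆ₐ[ℂ] (H →L[ℂ] H))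
    (hr : r ∈ Set.Ico (0 : ℝ) 1) (g : C(Circle, ℂ)) :
    ‖Φ (poisson hr g) - Ψ (poisson hr g)‖ ≤
      2 * r / (1 - r ^ 2) * ‖g‖ * ‖Φ coord - Ψ coord‖ := by
  have hΦ := continuous_starAlgHom Φ
  have hΨ := continuous_starAlgHom Ψ
  have h := map_poisson hr (toCLM Φ - toCLM Ψ) g
  simp only [sub_apply, toCLM_apply] at h
  have h1 : ∀ ζ, g ζ • (Φ (kernel hr ζ) - Ψ (kernel hr ζ)) =
      g ζ • (Φ (szego hr ζ) - Ψ (szego hr ζ)) +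
        star ((star g) ζ • (Φ (szego hr ζ) - Ψ (szego hr ζ))) := fun ζ => by
    rw [kernel_apply, star_smul, ContinuousMap.star_apply, star_star, ← smul_add, star_sub,
      map_sub, map_sub, map_add, map_add, map_one, map_one, map_star, map_star]
    congr 1
    abel
  have h2 : ∫ ζ, star ((star g) ζ • (Φ (szego hr ζ) - Ψ (szego hr ζ))) ∂haar =
      star (∫ ζ, (star g) ζ • (Φ (szego hr ζ) - Ψ (szego hr ζ)) ∂haar) :=
    ((starL' ℝ : (H →L[ℂ] H) ≃L[ℝ] (H →L[ℂ] H)) : (H →L[ℂ] H) →L[ℝ] (H →L[ℂ] H)).integral_comp_comm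
      (integrable_of_continuous (by fun_prop))
  simp_rw [h1] at h
  rw [h, integral_add (integrable_of_continuous (by fun_prop))
    (integrable_of_continuous (by fun_prop)), h2]
  refine (norm_add_le _ _).trans ?_
  rw [norm_star]
  have h3 := norm_integral_szego_le Φ Ψ hr g
  have h4 := norm_integral_szego_le Φ Ψ hr (star g)
  rw [norm_star] at h4
  refine (add_le_add h3 h4).trans_eq ?_
  ring

/-- The kernel `2 P_r - P_{r²}`, a positive kernel decaying faster than the Poisson kernel. -/
def doubleKernel (hr : r ∈ Set.Ico (0 : ℝ) 1) : C(Circle, C(Circle, ℂ)) :=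
  (2 : ℂ) • kernel hr - kernel (mul_mem_Ico hr hr)

lemma doubleKernel_apply (hr : r ∈ Set.Ico (0 : ℝ) 1) (w : Circle) :
    doubleKernel hr w = (2 : ℂ) • kernel hr w - kernel (mul_mem_Ico hr hr) w := rfl

/-- Convolution with `2 P_r - P_{r²}`. -/
def doublePoisson (hr : r ∈ Set.Ico (0 : ℝ) 1) (f : C(Circle, ℂ)) : C(Circle, ℂ) :=
  (2 : ℂ) • poisson hr f - poisson (mul_mem_Ico hr hr) f

lemma doublePoisson_apply (hr : r ∈ Set.Ico (0 : ℝ) 1) (f : C(Circle, ℂ)) (w : Circle) :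
    doublePoisson hr f w = mean (f * doubleKernel hr w) := by
  simp [doublePoisson, doubleKernel_apply, poisson_apply, mul_sub]

lemma norm_sq_szego (hr : r ∈ Set.Ico (0 : ℝ) 1) (w ζ : Circle) :
    ‖szego hr w ζ‖ ^ 2 = (1 + r ^ 2 - 2 * r * ((w⁻¹ * ζ : Circle) : ℂ).re)⁻¹ := by
  rw [szego_apply, norm_inv, inv_pow, ← Complex.normSq_eq_norm_sq, mul_assoc, ← Circle.coe_mul,
    Complex.normSq_sub, Complex.normSq_mul, Circle.normSq_coe]
  simp
  ring

lemma norm_doubleKernel (hr : r ∈ Set.Ico (0 : ℝ) 1) (w ζ : Circle) :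
    ((‖doubleKernel hr w ζ‖ : ℝ) : ℂ) = doubleKernel hr w ζ := by
  have h : doubleKernel hr w ζ = ((2 * ((1 - r ^ 2) * ‖szego hr w ζ‖ ^ 2) -
      (1 - (r * r) ^ 2) * ‖szego (mul_mem_Ico hr hr) w ζ‖ ^ 2 : ℝ) : ℂ) := by
    rw [doubleKernel_apply, Complex.ofReal_sub, Complex.ofReal_mul, ← kernel_eq_ofReal,
      ← kernel_eq_ofReal]
    simp
  rw [h, Complex.norm_real, Real.norm_of_nonneg]
  rw [norm_sq_szego, norm_sq_szego]
  set c := ((w⁻¹ * ζ : Circle) : ℂ).re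
  have hc : |c| ≤ 1 := (Complex.abs_re_le_norm _).trans (Circle.norm_coe _).le
  obtain ⟨hc1, hc2⟩ := abs_le.1 hc
  obtain ⟨h0, h1⟩ := hr
  have hA : 0 < 1 + r ^ 2 - 2 * r * c := by
    nlinarith [mul_nonneg h0 (sub_nonneg.2 hc2), sq_pos_of_pos (sub_pos.2 h1)]
  have hB : 0 < 1 + (r * r) ^ 2 - 2 * (r * r) * c := by
    have : 0 < 1 - r * r := by nlinarith
    nlinarith [mul_nonneg (mul_nonneg h0 h0) (sub_nonneg.2 hc2), sq_pos_of_pos this]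
  have e : 2 * ((1 - r ^ 2) * (1 + r ^ 2 - 2 * r * c)⁻¹) -
      (1 - (r * r) ^ 2) * (1 + (r * r) ^ 2 - 2 * (r * r) * c)⁻¹ =
      (1 - r ^ 2) * (1 - r) ^ 2 * ((1 + r ^ 2) + 2 * r * (1 + c)) /
        ((1 + r ^ 2 - 2 * r * c) * (1 + (r * r) ^ 2 - 2 * (r * r) * c)) := by
    rw [eq_div_iff (mul_pos hA hB).ne']
    linear_combination 2 * (1 - r ^ 2) * (1 + (r * r) ^ 2 - 2 * (r * r) * c) *
      inv_mul_cancel₀ hA.ne' - (1 - (r * r) ^ 2) * (1 + r ^ 2 - 2 * r * c) * inv_mul_cancel₀ hB.ne'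
  rw [e]
  have h2 : 0 ≤ 1 - r ^ 2 := by nlinarith
  have h3 : 0 ≤ 1 + c := by linarith
  positivity

lemma rpow_le_one_add_sq {u α : ℝ} (hu : 0 ≤ u) (h0 : 0 ≤ α) (h2 : α ≤ 2) :
    u ^ α ≤ 1 + u ^ 2 := by
  rcases le_total u 1 with h | h
  · have := Real.rpow_le_one hu h h0
    nlinarith [sq_nonneg u]
  · have := Real.rpow_le_rpow_of_exponent_le h h2
    rw [Real.rpow_two] at this
    linarith

lemma doublePoisson_one (hr : r ∈ Set.Ico (0 : ℝ) 1) : doublePoisson hr 1 = 1 := by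
  simp only [doublePoisson, poisson_one]
  module

lemma integral_doubleKernel (hr : r ∈ Set.Ico (0 : ℝ) 1) (w : Circle) :
    ∫ ζ : Circle, (1 + (‖(w : ℂ) - ζ‖ / (1 - r)) ^ 2) * ‖doubleKernel hr w ζ‖ ∂haar = 3 := by
  have hs : (1 : ℂ) - r ≠ 0 := by
    have := hr.2
    exact_mod_cast (sub_pos.2 this).ne'
  set h : C(Circle, ℂ) := 1 + ((1 - r : ℂ)⁻¹ ^ 2) •
    ((2 : ℂ) • 1 - (w : ℂ) • star coord - ((w⁻¹ : Circle) : ℂ) • coord)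
  have hz : ∀ {s : ℝ} (hs : s ∈ Set.Ico (0 : ℝ) 1), poisson hs coord = (s : ℂ) • coord :=
    fun hs => by
    simpa using poisson_coord_pow hs 1
  have h1 : doublePoisson hr h w = 3 := by
    simp only [doublePoisson, h, map_add, map_sub, map_smul, poisson_one, poisson_star, hz]
    simp [← Circle.coe_inv_eq_conj]
    field_simp
    ring
  have h2 : ∀ ζ : Circle, (((1 + (‖(w : ℂ) - ζ‖ / (1 - r)) ^ 2) * ‖doubleKernel hr w ζ‖ : ℝ) : ℂ) =
      (h * doubleKernel hr w) ζ := fun ζ => by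
    rw [Complex.ofReal_mul, norm_doubleKernel, ContinuousMap.mul_apply, div_pow, Complex.ofReal_add,
      Complex.ofReal_div, ← Complex.normSq_eq_norm_sq, Complex.normSq_eq_conj_mul_self]
    congr 1
    simp [h, ← Circle.coe_inv_eq_conj]
    field_simp
    ring
  rw [doublePoisson_apply, mean_apply, ← integral_congr_ae (.of_forall h2),
    integral_complex_ofReal] at h1
  exact_mod_cast h1

/-- The Jackson-type estimate for `2 P_r - P_{r²}`. -/
theorem norm_sub_doublePoisson_le (hr : r ∈ Set.Ico (0 : ℝ) 1) (f : C(Circle, ℂ)) {L α : ℝ}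
    (hL : 0 ≤ L) (h0 : 0 ≤ α) (h2 : α ≤ 2)
    (hf : ∀ w ζ : Circle, ‖f w - f ζ‖ ≤ L * ‖(w : ℂ) - ζ‖ ^ α) :
    ‖f - doublePoisson hr f‖ ≤ 3 * L * (1 - r) ^ α := by
  have hs : 0 < 1 - r := sub_pos.2 hr.2
  refine (ContinuousMap.norm_le _ (by positivity)).2 fun w => ?_
  have e : (f - doublePoisson hr f) w = mean ((f w • 1 - f) * doubleKernel hr w) := by
    rw [sub_mul, map_sub, smul_mul_assoc, map_smul, ← doublePoisson_apply, ← doublePoisson_apply,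
      doublePoisson_one]
    simp
  have hpt : ∀ ζ, ‖((f w • 1 - f) * doubleKernel hr w) ζ‖ ≤ L * (1 - r) ^ α *
      ((1 + (‖(w : ℂ) - ζ‖ / (1 - r)) ^ 2) * ‖doubleKernel hr w ζ‖) := fun ζ => by
    rw [ContinuousMap.mul_apply, norm_mul, ← mul_assoc]
    gcongr
    have h := rpow_le_one_add_sq (u := ‖(w : ℂ) - ζ‖ / (1 - r)) (by positivity) h0 h2
    rw [Real.div_rpow (norm_nonneg _) hs.le, div_le_iff₀ (by positivity)] at h
    calc ‖(f w • 1 - f) ζ‖ = ‖f w - f ζ‖ := by simp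
      _ ≤ L * ‖(w : ℂ) - ζ‖ ^ α := hf w ζ
      _ ≤ L * ((1 + (‖(w : ℂ) - ζ‖ / (1 - r)) ^ 2) * (1 - r) ^ α) := by gcongr
      _ = _ := by ring
  rw [e, mean_apply]
  refine (norm_integral_le_of_norm_le (integrable_of_continuous (by fun_prop))
    (.of_forall hpt)).trans_eq ?_
  rw [integral_const_mul, integral_doubleKernel]
  ring

lemma doublePoisson_sub (hr : r ∈ Set.Ico (0 : ℝ) 1) (f : C(Circle, ℂ)) :
    doublePoisson hr f - doublePoisson (mul_mem_Ico hr hr) f =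
      poisson hr ((2 : ℂ) • (f - doublePoisson hr f) + poisson hr (f - doublePoisson hr f)) := by
  have h1 := fun g => (poisson_poisson hr hr g).symm
  have h2 := fun g => (poisson_poisson (mul_mem_Ico hr hr) (mul_mem_Ico hr hr) g).symm
  simp only [doublePoisson, h2, h1, map_add, map_sub, map_smul]
  module

lemma doublePoisson_eq (hr : r ∈ Set.Ico (0 : ℝ) 1) (f : C(Circle, ℂ)) :
    doublePoisson hr f = poisson hr ((2 : ℂ) • f - poisson hr f) := by
  rw [doublePoisson, ← poisson_poisson, map_sub, map_smul]

lemma exp_neg_mem {t : ℝ} (ht : 0 < t) : Real.exp (-t) ∈ Set.Ico (0 : ℝ) 1 :=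
  ⟨(Real.exp_pos _).le, Real.exp_lt_one_iff.2 (neg_lt_zero.2 ht)⟩

lemma two_mul_exp_neg_div_le {t : ℝ} (ht : 0 < t) :
    2 * Real.exp (-t) / (1 - Real.exp (-t) ^ 2) ≤ t⁻¹ := by
  have h := Real.self_le_sinh_iff.2 ht.le
  rw [Real.sinh_eq] at h
  have h1 := exp_neg_mem ht
  have h2 : 0 < 1 - Real.exp (-t) ^ 2 := by nlinarith [h1.1, h1.2]
  have h3 : Real.exp t * Real.exp (-t) = 1 := by rw [← Real.exp_add]; simp
  rw [div_le_iff₀ h2, ← div_eq_inv_mul, le_div_iff₀ ht]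
  nlinarith [mul_le_mul_of_nonneg_left h h1.1]

lemma norm_sub_doublePoisson_exp_le {t : ℝ} (ht : 0 < t) (f : C(Circle, ℂ)) {L α : ℝ}
    (hL : 0 ≤ L) (h0 : 0 ≤ α) (h2 : α ≤ 2)
    (hf : ∀ w ζ : Circle, ‖f w - f ζ‖ ≤ L * ‖(w : ℂ) - ζ‖ ^ α) :
    ‖f - doublePoisson (exp_neg_mem ht) f‖ ≤ 3 * L * t ^ α := by
  refine (norm_sub_doublePoisson_le (exp_neg_mem ht) f hL h0 h2 hf).trans ?_
  have := Real.add_one_le_exp (-t)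
  have h1 := (exp_neg_mem ht).2
  gcongr
  linarith

/-- The dyadic sum of the Bernstein estimates. -/
lemma norm_map_doublePoisson_le (Φ Ψ : C(Circle, ℂ) →⋆ₐ[ℂ] (H →L[ℂ] H))
    (f : C(Circle, ℂ)) {L α : ℝ} (hL : 0 ≤ L) (h0 : 0 ≤ α) (h1 : α < 1)
    (hf : ∀ w ζ : Circle, ‖f w - f ζ‖ ≤ L * ‖(w : ℂ) - ζ‖ ^ α) (n : ℕ) :
    ∀ {t : ℝ} (ht : 0 < t), ‖Φ (doublePoisson (exp_neg_mem ht) f) -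
        Ψ (doublePoisson (exp_neg_mem ht) f)‖ ≤
      9 * L * ‖Φ coord - Ψ coord‖ * t ^ (α - 1) / (1 - 2 ^ (α - 1)) +
        3 * ‖f‖ * ‖Φ coord - Ψ coord‖ / (2 ^ n * t) := by
  set δ := ‖Φ coord - Ψ coord‖
  have hδ : 0 ≤ δ := norm_nonneg _
  have hq : 0 < 1 - (2 : ℝ) ^ (α - 1) :=
    sub_pos.2 (Real.rpow_lt_one_of_one_lt_of_neg one_lt_two (by linarith))
  have bern : ∀ {t : ℝ} (ht : 0 < t) (g : C(Circle, ℂ)) {C : ℝ}, ‖g‖ ≤ C →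
      ‖Φ (poisson (exp_neg_mem ht) g) - Ψ (poisson (exp_neg_mem ht) g)‖ ≤ t⁻¹ * C * δ :=
    fun ht g C hC => by
      refine (norm_sub_poisson_le Φ Ψ (exp_neg_mem ht) g).trans ?_
      gcongr
      exact two_mul_exp_neg_div_le ht
  induction n with
  | zero =>
    intro t ht
    rw [doublePoisson_eq]
    refine (bern ht _ (C := 3 * ‖f‖) ?_).trans ?_
    · refine (norm_sub_le _ _).trans ?_
      have := norm_poisson_le (exp_neg_mem ht) f
      rw [norm_smul, Complex.norm_ofNat]
      linarith
    · have : 0 ≤ 9 * L * δ * t ^ (α - 1) / (1 - 2 ^ (α - 1)) := by positivity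
      have e : t⁻¹ * (3 * ‖f‖) * δ = 3 * ‖f‖ * δ / (2 ^ 0 * t) := by
        rw [pow_zero, one_mul, div_eq_mul_inv]; ring
      linarith
  | succ n ih =>
    intro t ht
    have hr := exp_neg_mem ht
    have ht2 : 0 < 2 * t := by positivity
    have e : ∀ {s : ℝ} (hs : s ∈ Set.Ico (0 : ℝ) 1), s = Real.exp (-t) * Real.exp (-t) →
        doublePoisson hs f = doublePoisson (mul_mem_Ico hr hr) f := by
      rintro _ _ rfl
      rfl
    have e2 := e (exp_neg_mem ht2) (by rw [← Real.exp_add]; ring_nf)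
    have hsub := doublePoisson_sub hr f
    rw [← e2] at hsub
    set E := f - doublePoisson hr f
    have hE : ‖E‖ ≤ 3 * L * t ^ α :=
      norm_sub_doublePoisson_exp_le ht f hL h0 (by linarith) hf
    have hstep := bern ht ((2 : ℂ) • E + poisson hr E) (C := 9 * L * t ^ α) (by
      refine (norm_add_le _ _).trans ?_
      have := norm_poisson_le hr E
      rw [norm_smul, Complex.norm_ofNat]
      linarith)
    rw [← hsub, map_sub, map_sub] at hstep
    have h2 := ih ht2
    set F := doublePoisson (exp_neg_mem ht2) f
    have key : Φ (doublePoisson hr f) - Ψ (doublePoisson hr f) =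
        (Φ (doublePoisson hr f) - Φ F - (Ψ (doublePoisson hr f) - Ψ F)) + (Φ F - Ψ F) := by abel
    rw [key]
    refine (norm_add_le _ _).trans ((add_le_add hstep h2).trans_eq ?_)
    rw [Real.mul_rpow zero_le_two ht.le, Real.rpow_sub_one ht.ne' α, pow_succ]
    field_simp
    ring

theorem norm_map_sub_map_le (Φ Ψ : C(Circle, ℂ) →⋆ₐ[ℂ] (H →L[ℂ] H))
    (f : C(Circle, ℂ)) {L α : ℝ} (hL : 0 ≤ L) (h0 : 0 < α) (h1 : α < 1)
    (hf : ∀ w ζ : Circle, ‖f w - f ζ‖ ≤ L * ‖(w : ℂ) - ζ‖ ^ α)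
    (hδ : 0 < ‖Φ coord - Ψ coord‖) :
    ‖Φ f - Ψ f‖ ≤ 15 / (1 - 2 ^ (α - 1)) * L * ‖Φ coord - Ψ coord‖ ^ α := by
  set δ := ‖Φ coord - Ψ coord‖
  have hq : 0 < 1 - (2 : ℝ) ^ (α - 1) :=
    sub_pos.2 (Real.rpow_lt_one_of_one_lt_of_neg one_lt_two (by linarith))
  have hq1 : 1 ≤ 1 / (1 - (2 : ℝ) ^ (α - 1)) := by
    rw [le_div_iff₀ hq]
    have : (0 : ℝ) < 2 ^ (α - 1) := by positivity
    linarith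
  set F := doublePoisson (exp_neg_mem hδ) f
  have hlim : Filter.Tendsto (fun n : ℕ => 9 * L * δ * δ ^ (α - 1) / (1 - 2 ^ (α - 1)) +
      3 * ‖f‖ * δ / (2 ^ n * δ)) Filter.atTop
      (nhds (9 * L * δ * δ ^ (α - 1) / (1 - 2 ^ (α - 1)) + 0)) := by
    refine tendsto_const_nhds.add (Filter.Tendsto.const_div_atTop ?_ _)
    exact (tendsto_pow_atTop_atTop_of_one_lt one_lt_two).atTop_mul_const hδ
  have hF : ‖Φ F - Ψ F‖ ≤ _ :=
    ge_of_tendsto' hlim fun n => norm_map_doublePoisson_le Φ Ψ f hL h0.le h1 hf n hδ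
  have hE : ‖f - F‖ ≤ 3 * L * δ ^ α :=
    norm_sub_doublePoisson_exp_le hδ f hL h0.le (by linarith) hf
  have key : Φ f - Ψ f = Φ (f - F) - Ψ (f - F) + (Φ F - Ψ F) := by
    rw [map_sub, map_sub]; abel
  have h3 := NonUnitalStarAlgHom.norm_apply_le Φ (f - F)
  have h4 := NonUnitalStarAlgHom.norm_apply_le Ψ (f - F)
  have h5 : 0 ≤ L * δ ^ α := by positivity
  rw [Real.rpow_sub_one hδ.ne' α] at hF
  calc ‖Φ f - Ψ f‖ ≤ ‖Φ (f - F)‖ + ‖Ψ (f - F)‖ + ‖Φ F - Ψ F‖ := by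
        rw [key]
        exact (norm_add_le _ _).trans (by gcongr; exact norm_sub_le _ _)
    _ ≤ 6 * (L * δ ^ α) * 1 + 9 * L * δ * (δ ^ α / δ) / (1 - 2 ^ (α - 1)) := by linarith
    _ ≤ 6 * (L * δ ^ α) * (1 / (1 - 2 ^ (α - 1))) +
        9 * L * δ * (δ ^ α / δ) / (1 - 2 ^ (α - 1)) := by gcongr
    _ = _ := by field_simp; ring

/-- The continuous functional calculus of a unitary operator on functions on the circle. -/
def unitaryHom (U : unitary (H →L[ℂ] H)) : C(Circle, ℂ) →⋆ₐ[ℂ] (H →L[ℂ] H) :=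
  (cfcHom (R := ℂ) (a := (U : H →L[ℂ] H)) (Unitary.coe_isStarNormal U)).comp
    (ContinuousMap.compStarAlgHom' ℂ ℂ
      ⟨fun z => (⟨z, spectrum.subset_circle_of_unitary U.2 z.2⟩ : Circle), by fun_prop⟩)

lemma unitaryHom_apply (U : unitary (H →L[ℂ] H)) (f : C(Circle, ℂ)) :
    unitaryHom U f = circleFun f U := by
  have hex : ∀ z : spectrum ℂ (U : H →L[ℂ] H),
      Function.extend (fun z : Circle => (z : ℂ)) f 0 z =
        f ⟨z, spectrum.subset_circle_of_unitary U.2 z.2⟩ := fun z =>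
    Circle.coe_injective.extend_apply f 0 ⟨z, spectrum.subset_circle_of_unitary U.2 z.2⟩
  have hc : ContinuousOn (Function.extend (fun z : Circle => (z : ℂ)) f 0)
      (spectrum ℂ (U : H →L[ℂ] H)) := by
    rw [continuousOn_iff_continuous_domRestrict]
    have : (spectrum ℂ (U : H →L[ℂ] H)).domRestrict (Function.extend (fun z : Circle => (z : ℂ)) f 0) =
        fun z : spectrum ℂ (U : H →L[ℂ] H) =>
          f ⟨z, spectrum.subset_circle_of_unitary U.2 (Subtype.prop z)⟩ := funext hex
    rw [this]
    fun_prop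
  rw [circleFun, cfc_apply _ _ (Unitary.coe_isStarNormal U) hc]
  change cfcHom _ _ = cfcHom _ _
  congr 1
  ext z
  exact (hex z).symm

lemma unitaryHom_coord (U : unitary (H →L[ℂ] H)) : unitaryHom U coord = U := by
  refine Eq.trans ?_ (cfcHom_id (R := ℂ) (Unitary.coe_isStarNormal U))
  change cfcHom _ _ = cfcHom _ _
  congr 1

end CirclePoisson

end

theorem mainTheorem4 :
    ∃ c : ℝ, 0 < c ∧
      ∀ (α : ℝ≥0), 0 < α → α < 1 →
      ∀ (f : Circle → ℂ), MemHolder α f →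
      ∀ (H : Type*) [NormedAddCommGroup H] [InnerProductSpace ℂ H] [CompleteSpace H]
        (U V : unitary (H →L[ℂ] H)),
        ‖circleFun f U - circleFun f V‖ ≤
          8 * c / (1 - (2 : ℝ) ^ ((α : ℝ) - 1)) * (nnHolderNorm α f : ℝ) *
            ‖(U : H →L[ℂ] H) - (V : H →L[ℂ] H)‖ ^ (α : ℝ) := by
  refine ⟨15 / 8, by norm_num, fun α h0 h1 f hf H _ _ _ U V => ?_⟩
  have hα : (0 : ℝ) < α := h0
  rcases eq_or_ne U V with rfl | hUV
  · simp [hα.ne']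
  let F : C(Circle, ℂ) := ⟨f, hf.holderWith.continuous h0⟩
  have hδ : 0 < ‖(U : H →L[ℂ] H) - (V : H →L[ℂ] H)‖ :=
    norm_pos_iff.2 (sub_ne_zero.2 fun h => hUV (Subtype.ext h))
  have h := CirclePoisson.norm_map_sub_map_le (CirclePoisson.unitaryHom U)
    (CirclePoisson.unitaryHom V) F (L := nnHolderNorm α f) (α := α) (NNReal.coe_nonneg _) hα
    (by exact_mod_cast h1) fun w ζ => by
      have hd : dist w ζ = ‖(w : ℂ) - ζ‖ := dist_eq_norm (w : ℂ) ζ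
      rw [← dist_eq_norm, ← hd]
      exact hf.holderWith.dist_le w ζ
  rw [CirclePoisson.unitaryHom_coord, CirclePoisson.unitaryHom_coord,
    CirclePoisson.unitaryHom_apply, CirclePoisson.unitaryHom_apply] at h
  refine (h hδ).trans_eq ?_
  norm_num
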